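/- Let $\Lambda\subset\mathbb{R}^{24}$ be the Leech lattice (the even unimodular lattice of rank $24$ without vectors of squared length $2$) in its standard coordinates, $\Lambda=\frac1{\sqrt8}\{x\in\mathbb{Z}^{24}:$ for some $m\in\{0,1\}$, all $x_i\equiv m \bmod 2$, $\{i:(x_i-m)/2\text{ odd}\}\in\mathcal{G}$ and $\sum_i x_i\equiv 4m\bmod 8\}$ with $\mathcal{G}$ the binary Golay code; equivalently, the $\mathbb{Z}$-span of the rows of its standard generator matrix. Here "norm" means squared length. Let $\varepsilon:\Lambda\times\Lambda\to\{\pm1\}$ be a $2$-cocycle with $\varepsilon(\lambda,\mu)=(-1)^{\lambda\cdot\mu}\varepsilon(\mu,\lambda)$, let $\widehat\Lambda$ be the corresponding central extension of $\Lambda$ by $\{\pm1\}$, let $K=\{a^2(-1)^{\bar a^2/2}: a\in\widehat\Lambda\}$, where $\bar a\in\Lambda$ is the image of $a$, and let $\Gamma(\Lambda)=\widehat\Lambda/K$, which projects onto $\Lambda/2\Lambda$. A sublattice $M\subseteq\Lambda$ is called *superconformal* if 1. $\lambda_1\cdot\lambda_2\in2\mathbb{Z}$ and $\lambda\cdot\lambda\in4\mathbb{Z}$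 for all $\lambda_1,\lambda_2,\lambda\in M$; 2. $M$ contains no vector of norm $4$; 3. $2\Lambda\subseteq M$ with index $2^{12}$ and, for a suitable section $[\lambda]\mapsto e_{[\lambda]}$ of $\Gamma(\Lambda)\to\Lambda/2\Lambda$ with $e_{[0]}=1$, the set $\{e_{[\lambda]}:[\lambda]\in M/2\Lambda\}$ is an Abelian subgroup of $\Gamma(\Lambda)$ of order $2^{12}$. **Theorem.** Cocycles $\varepsilon$ as above exist, and the minimum norm of nonzero vectors of $\Lambda$ is $4$. There is an isometric embedding (an additive map preserving inner products) $\iota:\sqrt2\Lambda\to\Lambda$, and for every such embedding and every cocycle $\varepsilon$ the image $\iota(\sqrt2\Lambda)$ is a superconformal sublattice of $\Lambda$. In particular, there exists a sublattice of $\Lambda$ that is superconformal for every choice of $\varepsilon$. -/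

import Mathlib

open scoped Pointwise RealInnerProductSpace

noncomputable section

namespace LeechSC

/-- Euclidean `24`-space. -/
abbrev E24 : Type := EuclideanSpace ℝ (Fin 24)

/-- The rows of `√8` times the standard generator matrix of the Leech lattice. -/
def leechRows : Fin 24 → Fin 24 → ℤ :=
  ![
    ![8, 0, 0, 0, 0, 0, 0, 0, 0, 0, 0, 0, 0, 0, 0, 0, 0, 0, 0, 0, 0, 0, 0, 0],
    ![4, 4, 0, 0, 0, 0, 0, 0, 0, 0, 0, 0, 0, 0, 0, 0, 0, 0, 0, 0, 0, 0, 0, 0],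
    ![4, 0, 4, 0, 0, 0, 0, 0, 0, 0, 0, 0, 0, 0, 0, 0, 0, 0, 0, 0, 0, 0, 0, 0],
    ![4, 0, 0, 4, 0, 0, 0, 0, 0, 0, 0, 0, 0, 0, 0, 0, 0, 0, 0, 0, 0, 0, 0, 0],
    ![4, 0, 0, 0, 4, 0, 0, 0, 0, 0, 0, 0, 0, 0, 0, 0, 0, 0, 0, 0, 0, 0, 0, 0],
    ![4, 0, 0, 0, 0, 4, 0, 0, 0, 0, 0, 0, 0, 0, 0, 0, 0, 0, 0, 0, 0, 0, 0, 0],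
    ![4, 0, 0, 0, 0, 0, 4, 0, 0, 0, 0, 0, 0, 0, 0, 0, 0, 0, 0, 0, 0, 0, 0, 0],
    ![2, 2, 2, 2, 2, 2, 2, 2, 0, 0, 0, 0, 0, 0, 0, 0, 0, 0, 0, 0, 0, 0, 0, 0],
    ![4, 0, 0, 0, 0, 0, 0, 0, 4, 0, 0, 0, 0, 0, 0, 0, 0, 0, 0, 0, 0, 0, 0, 0],
    ![4, 0, 0, 0, 0, 0, 0, 0, 0, 4, 0, 0, 0, 0, 0, 0, 0, 0, 0, 0, 0, 0, 0, 0],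
    ![4, 0, 0, 0, 0, 0, 0, 0, 0, 0, 4, 0, 0, 0, 0, 0, 0, 0, 0, 0, 0, 0, 0, 0],
    ![2, 2, 2, 2, 0, 0, 0, 0, 2, 2, 2, 2, 0, 0, 0, 0, 0, 0, 0, 0, 0, 0, 0, 0],
    ![4, 0, 0, 0, 0, 0, 0, 0, 0, 0, 0, 0, 4, 0, 0, 0, 0, 0, 0, 0, 0, 0, 0, 0],
    ![2, 2, 0, 0, 2, 2, 0, 0, 2, 2, 0, 0, 2, 2, 0, 0, 0, 0, 0, 0, 0, 0, 0, 0],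
    ![2, 0, 2, 0, 2, 0, 2, 0, 2, 0, 2, 0, 2, 0, 2, 0, 0, 0, 0, 0, 0, 0, 0, 0],
    ![2, 0, 0, 2, 2, 0, 0, 2, 2, 0, 0, 2, 2, 0, 0, 2, 0, 0, 0, 0, 0, 0, 0, 0],
    ![4, 0, 0, 0, 0, 0, 0, 0, 0, 0, 0, 0, 0, 0, 0, 0, 4, 0, 0, 0, 0, 0, 0, 0],
    ![2, 0, 2, 0, 2, 0, 0, 2, 2, 2, 0, 0, 0, 0, 0, 0, 2, 2, 0, 0, 0, 0, 0, 0],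
    ![2, 0, 0, 2, 2, 2, 0, 0, 2, 0, 2, 0, 0, 0, 0, 0, 2, 0, 2, 0, 0, 0, 0, 0],
    ![2, 2, 0, 0, 2, 0, 2, 0, 2, 0, 0, 2, 0, 0, 0, 0, 2, 0, 0, 2, 0, 0, 0, 0],
    ![0, 2, 2, 2, 2, 0, 0, 0, 2, 0, 0, 0, 2, 0, 0, 0, 2, 0, 0, 0, 2, 0, 0, 0],
    ![0, 0, 0, 0, 0, 0, 0, 0, 2, 2, 0, 0, 2, 2, 0, 0, 2, 2, 0, 0, 2, 2, 0, 0],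
    ![0, 0, 0, 0, 0, 0, 0, 0, 2, 0, 2, 0, 2, 0, 2, 0, 2, 0, 2, 0, 2, 0, 2, 0],
    ![-3, 1, 1, 1, 1, 1, 1, 1, 1, 1, 1, 1, 1, 1, 1, 1, 1, 1, 1, 1, 1, 1, 1, 1]]

/-- The generators of the Leech lattice: the rows of the generator matrix, `1 / (2√2)` times
the integral rows above. -/
def leechVec (i : Fin 24) : E24 :=
  WithLp.toLp 2 fun j => (leechRows i j : ℝ) / (2 * Real.sqrt 2)

/-- The Leech lattice `Λ`: all integral combinations of the rows of the generator matrix. -/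
def leech : AddSubgroup E24 := AddSubgroup.closure (Set.range leechVec)

/-- The lattice `√2 Λ = {√2 x : x ∈ Λ}`. -/
def sqrtTwoLeech : AddSubgroup E24 := (Real.sqrt 2) • leech

/-- `2Λ`, as a subgroup of `Λ`. -/
def twoLeech : AddSubgroup leech := (nsmulAddMonoidHom 2 : leech →+ leech).range

/-- The quotient `Λ / 2Λ`. -/
abbrev LeechModTwo : Type := leech ⧸ twoLeech

/-- Isometric embeddings of `√2 Λ` into `Λ`: additive maps preserving the inner product
(these are automatically injective). -/
def IsIsometricEmbedding (ι : sqrtTwoLeech →+ leech) : Prop :=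
  ∀ x y : sqrtTwoLeech, ⟪(ι x : E24), (ι y : E24)⟫ = ⟪(x : E24), (y : E24)⟫

/-! ### The lattice is even, so that signs `(-1)^(λ·μ)` and `(-1)^(λ²/2)` make sense -/

theorem leechRows_gram :
    ∀ i j, (∑ k, leechRows i k * leechRows j k) % 8 = 0 := by
  decide +kernel

theorem leechRows_norm :
    ∀ i, (∑ k, leechRows i k * leechRows i k) % 16 = 0 := by
  decide +kernel

theorem leechVec_inner (i j : Fin 24) :
    ⟪leechVec i, leechVec j⟫ = ((∑ k, leechRows i k * leechRows j k : ℤ) : ℝ) / 8 := by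
  have h : Real.sqrt 2 * Real.sqrt 2 = 2 := Real.mul_self_sqrt (by norm_num)
  simp only [leechVec, PiLp.inner_apply, RCLike.inner_apply, conj_trivial]
  push_cast
  rw [Finset.sum_div]
  refine Finset.sum_congr rfl fun k _ => ?_
  rw [div_mul_div_comm]
  congr 1
  · ring
  · linear_combination 4 * h

theorem exists_inner_eq {x y : E24} (hx : x ∈ leech) (hy : y ∈ leech) :
    ∃ n : ℤ, ⟪x, y⟫ = (n : ℝ) := by
  induction hx, hy using AddSubgroup.closure_induction₂ with
  | mem x y hx hy =>
    obtain ⟨i, rfl⟩ := hx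
    obtain ⟨j, rfl⟩ := hy
    obtain ⟨n, hn⟩ := Int.dvd_of_emod_eq_zero (leechRows_gram i j)
    exact ⟨n, by rw [leechVec_inner, hn]; push_cast; ring⟩
  | zero_left x _ => exact ⟨0, by simp⟩
  | zero_right x _ => exact ⟨0, by simp⟩
  | add_left x y z _ _ _ h1 h2 =>
    obtain ⟨a, ha⟩ := h1
    obtain ⟨b, hb⟩ := h2
    exact ⟨a + b, by rw [inner_add_left, ha, hb]; push_cast; ring⟩
  | add_right x y z _ _ _ h1 h2 =>
    obtain ⟨a, ha⟩ := h1
    obtain ⟨b, hb⟩ := h2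
    exact ⟨a + b, by rw [inner_add_right, ha, hb]; push_cast; ring⟩
  | neg_left x y _ _ h =>
    obtain ⟨a, ha⟩ := h
    exact ⟨-a, by rw [inner_neg_left, ha]; push_cast; ring⟩
  | neg_right x y _ _ h =>
    obtain ⟨a, ha⟩ := h
    exact ⟨-a, by rw [inner_neg_right, ha]; push_cast; ring⟩

theorem exists_norm_sq_eq {x : E24} (hx : x ∈ leech) :
    ∃ n : ℤ, ⟪x, x⟫ = 2 * (n : ℝ) := by
  induction hx using AddSubgroup.closure_induction with
  | mem x hx =>
    obtain ⟨i, rfl⟩ := hx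
    obtain ⟨n, hn⟩ := Int.dvd_of_emod_eq_zero (leechRows_norm i)
    exact ⟨n, by rw [leechVec_inner, hn]; push_cast; ring⟩
  | zero => exact ⟨0, by simp⟩
  | add x y hx hy h1 h2 =>
    obtain ⟨a, ha⟩ := h1
    obtain ⟨b, hb⟩ := h2
    obtain ⟨c, hc⟩ := exists_inner_eq hx hy
    exact ⟨a + b + c, by rw [real_inner_add_add_self, ha, hb, hc]; push_cast; ring⟩
  | neg x _ h => simpa using h

/-- The inner product `λ·μ` of two lattice vectors, as an integer. -/
def ip (x y : leech) : ℤ := (exists_inner_eq x.2 y.2).choose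

theorem ip_spec (x y : leech) : ⟪(x : E24), (y : E24)⟫ = (ip x y : ℝ) :=
  (exists_inner_eq x.2 y.2).choose_spec

/-- `λ²/2` for a lattice vector, as an integer. -/
def halfNorm (x : leech) : ℤ := (exists_norm_sq_eq x.2).choose

theorem halfNorm_spec (x : leech) : ⟪(x : E24), (x : E24)⟫ = 2 * (halfNorm x : ℝ) :=
  (exists_norm_sq_eq x.2).choose_spec

theorem halfNorm_add (x y : leech) : halfNorm (x + y) = halfNorm x + halfNorm y + ip x y := by
  have h := halfNorm_spec (x + y)
  rw [AddSubgroup.coe_add, real_inner_add_add_self, halfNorm_spec, halfNorm_spec, ip_spec] at h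
  have : (2 * halfNorm (x + y) : ℝ) = 2 * (halfNorm x + halfNorm y + ip x y) := by linarith
  have h2 : (halfNorm (x + y) : ℝ) = ((halfNorm x + halfNorm y + ip x y : ℤ) : ℝ) := by
    push_cast; linarith
  exact_mod_cast h2

theorem halfNorm_neg (x : leech) : halfNorm (-x) = halfNorm x := by
  have h := halfNorm_spec (-x)
  rw [AddSubgroup.coe_neg, inner_neg_neg, halfNorm_spec] at h
  have : (halfNorm (-x) : ℝ) = halfNorm x := by linarith
  exact_mod_cast this

theorem ip_add_left (x y z : leech) : ip (x + y) z = ip x z + ip y z := by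
  have h := ip_spec (x + y) z
  rw [AddSubgroup.coe_add, inner_add_left, ip_spec, ip_spec] at h
  exact_mod_cast h.symm

theorem halfNorm_zero : halfNorm 0 = 0 := by
  have h := halfNorm_spec 0
  simp at h
  exact_mod_cast h

/-! ### The central extension of `Λ` and the Heisenberg group `Γ(Λ)` -/

/-- Sign-valued `2`-cocycles on `Λ` with commutator function `(-1)^(λ·μ)`. -/
structure LeechCocycle where
  toFun : leech → leech → ℤˣ
  cocycle : ∀ x y z, toFun x y * toFun (x + y) z = toFun x (y + z) * toFun y z
  commutator : ∀ x y, toFun x y = (-1) ^ ip x y * toFun y x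

/-- The extension of `Λ` by the signs `{±1}` defined by a cocycle `ε`: pairs `(s, λ)` with
`(s, λ) (t, μ) = (s t ε(λ, μ), λ + μ)`. -/
@[ext]
structure LeechHat (ε : LeechCocycle) where
  sign : ℤˣ
  vec : leech

namespace LeechHat

variable {ε : LeechCocycle}

instance : Mul (LeechHat ε) := ⟨fun a b => ⟨a.sign * b.sign * ε.toFun a.vec b.vec, a.vec + b.vec⟩⟩

instance : One (LeechHat ε) := ⟨⟨ε.toFun 0 0, 0⟩⟩

instance : Inv (LeechHat ε) :=
  ⟨fun a => ⟨a.sign * ε.toFun 0 0 * ε.toFun (-a.vec) a.vec, -a.vec⟩⟩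

@[simp] theorem mul_sign (a b : LeechHat ε) :
    (a * b).sign = a.sign * b.sign * ε.toFun a.vec b.vec := rfl
@[simp] theorem mul_vec (a b : LeechHat ε) : (a * b).vec = a.vec + b.vec := rfl
@[simp] theorem one_sign : (1 : LeechHat ε).sign = ε.toFun 0 0 := rfl
@[simp] theorem one_vec : (1 : LeechHat ε).vec = 0 := rfl
@[simp] theorem inv_sign (a : LeechHat ε) :
    (a⁻¹).sign = a.sign * ε.toFun 0 0 * ε.toFun (-a.vec) a.vec := rfl
@[simp] theorem inv_vec (a : LeechHat ε) : (a⁻¹).vec = -a.vec := rfl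

theorem cocycle_zero_left (x : leech) : ε.toFun 0 x = ε.toFun 0 0 := by
  have h := ε.cocycle 0 0 x
  simp only [zero_add] at h
  exact (mul_right_cancel h).symm

theorem cocycle_zero_right (x : leech) : ε.toFun x 0 = ε.toFun 0 0 := by
  have h := ε.cocycle x 0 0
  simp only [add_zero] at h
  exact mul_left_cancel h

instance : Group (LeechHat ε) :=
  Group.ofLeftAxioms
    (by
      intro a b c
      ext1
      · have h := ε.cocycle a.vec b.vec c.vec
        simp only [mul_sign, mul_vec]
        calc _ = a.sign * b.sign * c.sign *
              (ε.toFun a.vec b.vec * ε.toFun (a.vec + b.vec) c.vec) := by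
              simp only [mul_comm, mul_left_comm, mul_assoc]
          _ = _ := by
              rw [h]; simp only [mul_comm, mul_left_comm, mul_assoc]
      · simp [add_assoc])
    (by
      intro a
      ext1
      · simp only [mul_sign, one_sign, one_vec, cocycle_zero_left]
        rw [mul_right_comm, Int.units_mul_self, one_mul]
      · simp)
    (by
      intro a
      ext1
      · simp only [mul_sign, inv_sign, inv_vec, one_sign]
        calc _ = (a.sign * a.sign) * (ε.toFun (-a.vec) a.vec * ε.toFun (-a.vec) a.vec) *
              ε.toFun 0 0 := by
              simp only [mul_comm, mul_left_comm, mul_assoc]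
          _ = _ := by rw [Int.units_mul_self, Int.units_mul_self, one_mul, one_mul]
      · simp)

/-- The inclusion of the central subgroup `{±1}` in the extension. -/
def central : ℤˣ →* LeechHat ε where
  toFun s := ⟨s * ε.toFun 0 0, 0⟩
  map_one' := by ext1 <;> simp
  map_mul' s t := by
    ext1
    · simp only [mul_sign]
      calc _ = s * t * ε.toFun 0 0 * 1 := by rw [mul_one]
        _ = s * t * ε.toFun 0 0 * (ε.toFun 0 0 * ε.toFun 0 0) := by rw [Int.units_mul_self]
        _ = _ := by simp only [mul_comm, mul_left_comm, mul_assoc]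
    · simp

theorem mul_central (a : LeechHat ε) (s : ℤˣ) :
    a * central s = ⟨a.sign * s, a.vec⟩ := by
  ext1
  · simp only [mul_sign, central, MonoidHom.coe_mk, OneHom.coe_mk, cocycle_zero_right]
    rw [← mul_assoc, mul_assoc (a.sign * s), Int.units_mul_self, mul_one]
  · simp [central]

theorem central_mul (a : LeechHat ε) (s : ℤˣ) : central s * a = a * central s := by
  rw [mul_central]
  ext1
  · simp only [mul_sign, central, MonoidHom.coe_mk, OneHom.coe_mk, cocycle_zero_left]
    rw [mul_right_comm, mul_assoc s, Int.units_mul_self, mul_one, mul_comm]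
  · simp [central]

theorem mul_eq (a b : LeechHat ε) : a * b = b * a * central ((-1) ^ ip a.vec b.vec) := by
  rw [mul_central]
  ext1
  · simp only [mul_sign]
    rw [ε.commutator a.vec b.vec]
    simp only [mul_comm, mul_left_comm, mul_assoc]
  · simp [add_comm]

/-- The square of any element is central. -/
theorem sq_mul (a b : LeechHat ε) : a * a * b = b * (a * a) := by
  have h := mul_eq (a * a) b
  rwa [mul_vec, ip_add_left, zpow_add, Int.units_mul_self, map_one, mul_one] at h

/-- The subgroup `K = {a² (-1)^(ā²/2)}` of the extension, where `ā` is the image of `a` in `Λ`. -/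
def K (ε : LeechCocycle) : Subgroup (LeechHat ε) where
  carrier := {b | ∃ a : LeechHat ε, b = a * a * central ((-1) ^ halfNorm a.vec)}
  one_mem' := ⟨1, by simp [halfNorm_zero]⟩
  mul_mem' := by
    rintro _ _ ⟨a, rfl⟩ ⟨b, rfl⟩
    refine ⟨b * a, ?_⟩
    have h1 : b * a * (b * a) = a * a * (b * b) * central ((-1) ^ ip a.vec b.vec) := by
      have h2 : a * b * a = b * (a * a) * central ((-1) ^ ip a.vec b.vec) := by
        rw [mul_eq a b, mul_assoc (b * a), central_mul, ← mul_assoc, mul_assoc b a a]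
      calc b * a * (b * a) = b * (a * b * a) := by simp only [mul_assoc]
        _ = b * (b * (a * a)) * central ((-1) ^ ip a.vec b.vec) := by
            rw [h2]; simp only [mul_assoc]
        _ = b * b * (a * a) * central ((-1) ^ ip a.vec b.vec) := by simp only [mul_assoc]
        _ = _ := by rw [sq_mul b (a * a)]
    rw [h1, mul_vec, add_comm b.vec a.vec, halfNorm_add, zpow_add, zpow_add, map_mul, map_mul]
    have hs : central ((-1) ^ ip a.vec b.vec) * central ((-1) ^ ip a.vec b.vec)
        = (1 : LeechHat ε) := by
      rw [← map_mul, Int.units_mul_self, map_one]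
    set A := a * a
    set B := b * b
    set c : LeechHat ε := central ((-1) ^ ip a.vec b.vec)
    calc A * central ((-1) ^ halfNorm a.vec) * (B * central ((-1) ^ halfNorm b.vec))
        = A * (central ((-1) ^ halfNorm a.vec) * B) * central ((-1) ^ halfNorm b.vec) := by
          simp only [mul_assoc]
      _ = A * B * (central ((-1) ^ halfNorm a.vec) * central ((-1) ^ halfNorm b.vec)) := by
          rw [central_mul]; simp only [mul_assoc]
      _ = A * B * (c * c) *
            (central ((-1) ^ halfNorm a.vec) * central ((-1) ^ halfNorm b.vec)) := by
          rw [hs, mul_one]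
      _ = _ := by
          rw [← central_mul _ ((-1) ^ ip a.vec b.vec)]; simp only [c, mul_assoc]
          rw [central_mul]; simp only [mul_assoc]
  inv_mem' := by
    rintro _ ⟨a, rfl⟩
    refine ⟨a⁻¹, ?_⟩
    rw [inv_vec, halfNorm_neg, mul_inv_rev, mul_inv_rev, ← map_inv, Int.units_inv_eq_self,
      central_mul]

instance (ε : LeechCocycle) : (K ε).Normal where
  conj_mem := by
    rintro _ ⟨a, rfl⟩ g
    refine ⟨a, ?_⟩
    rw [← mul_assoc, ← sq_mul, mul_assoc (a * a), ← central_mul, ← mul_assoc, mul_assoc _ g,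
      mul_inv_cancel, mul_one]

/-- The projection of the extension to `Λ / 2Λ`. -/
def toModTwo (ε : LeechCocycle) : LeechHat ε →* Multiplicative LeechModTwo where
  toFun a := Multiplicative.ofAdd (a.vec : LeechModTwo)
  map_one' := rfl
  map_mul' _ _ := rfl

end LeechHat

/-- The Heisenberg group `Γ(Λ)`: the quotient of the extension by `K`. -/
abbrev Heis (ε : LeechCocycle) : Type := LeechHat ε ⧸ LeechHat.K ε

/-- The projection `Γ(Λ) → Λ / 2Λ`. -/
def Heis.bar (ε : LeechCocycle) : Heis ε →* Multiplicative LeechModTwo :=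
  QuotientGroup.lift (LeechHat.K ε) (LeechHat.toModTwo ε) (by
    rintro _ ⟨a, rfl⟩
    refine congrArg Multiplicative.ofAdd ((QuotientAddGroup.eq_zero_iff _).2 ⟨a.vec, ?_⟩)
    rw [LeechHat.mul_central]
    simp [two_nsmul])

/-- Sections `[λ] ↦ e_[λ]` of `Γ(Λ) → Λ / 2Λ` with `e_[0] = 1`. -/
structure Heis.Section (ε : LeechCocycle) where
  toFun : LeechModTwo → Heis ε
  bar_toFun : ∀ x, Heis.bar ε (toFun x) = Multiplicative.ofAdd x
  map_zero : toFun 0 = 1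

/-- A sublattice `M` of the Leech lattice is superconformal if all inner products in `M` are even
and all norms (squared lengths) are divisible by `4`; no vector of `M` has norm `4`;
`2Λ ⊆ M` with index `2^12`; and, for a suitable choice of the section `e`, the set
`{e_[λ] : [λ] ∈ M / 2Λ}` is an Abelian subgroup of order `2^12` of `Γ(Λ)`. -/
structure IsSuperconformal (ε : LeechCocycle) (M : AddSubgroup leech) : Prop where
  inner_even : ∀ x ∈ M, ∀ y ∈ M, ∃ k : ℤ, ⟪(x : E24), (y : E24)⟫ = 2 * (k : ℝ)
  norm_div_four : ∀ x ∈ M, ∃ k : ℤ, ‖(x : E24)‖ ^ 2 = 4 * (k : ℝ)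
  norm_ne_four : ∀ x ∈ M, ‖(x : E24)‖ ^ 2 ≠ 4
  two_le : twoLeech ≤ M
  index_eq : twoLeech.relIndex M = 2 ^ 12
  lift : ∃ (e : Heis.Section ε) (H : Subgroup (Heis ε)),
    (H : Set (Heis ε)) = e.toFun '' (M.map (QuotientAddGroup.mk' twoLeech) : Set LeechModTwo) ∧
    (∀ g ∈ H, ∀ h ∈ H, g * h = h * g) ∧ Nat.card H = 2 ^ 12

end LeechSC

end

/-! Composing with multiplication by `√2` turns isometric embeddings of `√2 Λ` into additive maps `f
: Λ → Λ` that double all inner products, so everything is about `M = f(Λ)` for such an `f`.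

Evenness of `Λ` gives even inner products and norms divisible by 4 on `M`, and a vector of norm 4 in
`M` would come from one of norm 2 in `Λ`. Norm 2 is excluded by parity in the standard coordinates
and the Golay minimum weight (`coords_sq_sum_ne`).

Unimodularity (`det_gram`) gives `f` an integral adjoint `f*` with `f* f = f f* = 2`, whence `2Λ ⊆
M` (`twoLeech_le_range`). Also `det f ^ 2 = 2 ^ 24`, so `M` has index `2 ^ 12` in `Λ`, half-way to
`2Λ`.

The preimage of `M / 2Λ` in `Γ(Λ)` is abelian because inner products on `M` are even, and of
exponent 2 because half-norms are even. It is thus an `F₂`-vector space, and its projection onto `M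
/ 2Λ` splits (`exists_abelian_lift`).

For existence, a signed coordinate permutation `σ` of `Λ` with `σ² = -1` is skew, so `1 + σ` doubles
inner products (`exists_similarity`). Cocycles come from splitting the even Gram matrix into
triangular halves (`ipForm_eq`). -/

noncomputable section

namespace LeechSC

/-! ### Explicit data for the Golay code and the similarity -/

/-- The supports of the Golay code words obtained from the rows of the generator matrix, written in
binary: the positions of the entries that are `2` modulo `4` in the first `23` rows, and in twice
the last row. -/
def golayWord : Fin 24 → ℕ :=
  ![0, 0, 0, 0, 0, 0, 0, 255, 0, 0, 0, 3855, 0, 13107, 21845, 39321, 0,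
    197525, 329017, 592211, 1118494, 3355392, 5592320, 16777215]

/-- A fixed point free involution of the coordinates, an automorphism of the Golay code. -/
def coordPerm : Fin 24 → Fin 24 :=
  ![5, 2, 1, 18, 10, 0, 12, 20, 16, 11, 4, 9, 6, 17, 22, 21, 8, 13, 3, 23, 7, 15, 14, 19]

/-- Signs which turn `coordPerm` into an isometry of the Leech lattice of square `-1`. -/
def coordSign : Fin 24 → ℤ :=
  ![-1, -1, 1, 1, 1, 1, 1, 1, 1, -1, -1, 1, -1, 1, -1, 1, -1, -1, -1, -1, -1, -1, 1, 1]

/-- The matrix of a similarity of the Leech lattice that doubles norms, in terms of the rows of the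
generator matrix. -/
def similarityMatrix : Fin 24 → Fin 24 → ℤ :=
  ![
    ![0, 0, 0, 0, 0, 2, 0, 0, 0, 0, 0, 0, 0, 0, 0, 0, 0, 0, 0, 0, 0, 0, 0, 0],
    ![-1, 1, 1, 0, 0, 1, 0, 0, 0, 0, 0, 0, 0, 0, 0, 0, 0, 0, 0, 0, 0, 0, 0, 0],
    ![0, -1, 1, 0, 0, 1, 0, 0, 0, 0, 0, 0, 0, 0, 0, 0, 0, 0, 0, 0, 0, 0, 0, 0],
    ![-3, 0, 0, 2, 1, 2, 0, 0, 1, 0, 1, 0, 0, 0, 0, 0, 1, 0, -2, 0, 0, 0, 0, 0],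
    ![0, 0, 0, 0, 1, 1, 0, 0, 0, 0, -1, 0, 0, 0, 0, 0, 0, 0, 0, 0, 0, 0, 0, 0],
    ![-1, 0, 0, 0, 0, 2, 0, 0, 0, 0, 0, 0, 0, 0, 0, 0, 0, 0, 0, 0, 0, 0, 0, 0],
    ![0, 0, 0, 0, 0, 1, 1, 0, 0, 0, 0, 0, -1, 0, 0, 0, 0, 0, 0, 0, 0, 0, 0, 0],
    ![-3, 0, 1, 1, 1, 1, 0, 1, 1, 0, 0, 0, 0, 0, 0, 0, 1, 0, -1, 0, -1, 0, 0, 0],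
    ![0, 0, 0, 0, 0, 1, 0, 0, 1, 0, 0, 0, 0, 0, 0, 0, -1, 0, 0, 0, 0, 0, 0, 0],
    ![2, -1, -1, -1, 0, 1, 0, 0, -1, 0, -1, 2, 0, 0, 0, 0, 0, 0, 0, 0, 0, 0, 0, 0],
    ![-1, 0, 0, 0, 1, 1, 0, 0, 0, 0, 1, 0, 0, 0, 0, 0, 0, 0, 0, 0, 0, 0, 0, 0],
    ![0, -1, 0, 0, 1, 1, 0, 0, 0, -1, 0, 2, 0, 0, 0, 0, 0, 0, -1, 0, 0, 0, 0, 0],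
    ![-1, 0, 0, 0, 0, 1, 1, 0, 0, 0, 0, 0, 1, 0, 0, 0, 0, 0, 0, 0, 0, 0, 0, 0],
    ![1, -1, 0, -1, 0, 0, 0, 1, 0, 0, -1, 1, 0, 1, 0, 0, 0, -1, 0, 0, 0, 0, 0, 0],
    ![-3, 0, 1, 1, 2, 1, 1, 0, 1, 0, 0, 0, 0, 0, 0, 0, 0, 0, -1, 0, -1, 0, 1, 0],
    ![-1, 0, 0, 1, 0, 1, 1, -1, 0, -1, 0, 0, 0, 1, 0, 1, 0, 1, -1, 0, 0, -1, 0, 0],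
    ![-1, 0, 0, 0, 0, 1, 0, 0, 1, 0, 0, 0, 0, 0, 0, 0, 1, 0, 0, 0, 0, 0, 0, 0],
    ![1, -1, 0, 0, 0, 0, 0, 0, 0, -1, -1, 1, 0, 1, 0, 0, 0, 1, 0, 0, -1, 0, 0, 0],
    ![-2, 0, 0, 1, 1, 1, 0, 0, 1, 0, 0, 0, 0, 0, 0, 0, 0, 0, 0, 0, 0, 0, 0, 0],
    ![3, -1, -1, -1, 0, 0, 0, 0, 1, -1, -1, 1, 0, 0, 0, -1, 0, 0, 0, 0, 1, -1, -1, 2],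
    ![0, -1, 0, 0, 0, 0, 0, 1, 1, 0, 0, 0, 0, 0, 0, 0, 0, 0, -1, 0, 1, 0, 0, 0],
    ![2, -1, 0, -1, -1, -1, 0, 1, 0, 0, 0, 0, -1, 1, 0, 1, 0, -1, 0, 0, 0, 1, 0, 0],
    ![-4, 0, 1, 1, 2, 0, 1, 1, 2, 0, 1, 0, 1, 0, -2, 0, 0, 0, -1, 0, -1, 0, 2, 0],
    ![0, -1, 0, 0, 1, -1, 1, 0, 1, -1, 0, 1, 0, 1, -1, 0, 1, 0, -1, -1, 0, -1, 0, 2]]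

/-! ### Vectors in the standard coordinates -/

/-- The vector of `E24` with standard coordinates `v`. -/
def ofCoords (v : Fin 24 → ℤ) : E24 := WithLp.toLp 2 fun k => (v k : ℝ) / (2 * Real.sqrt 2)

theorem ofCoords_inner (v w : Fin 24 → ℤ) :
    ⟪ofCoords v, ofCoords w⟫ = ((∑ k, v k * w k : ℤ) : ℝ) / 8 := by
  have h : Real.sqrt 2 * Real.sqrt 2 = 2 := Real.mul_self_sqrt (by norm_num)
  simp only [ofCoords, PiLp.inner_apply, RCLike.inner_apply, conj_trivial]
  push_cast
  rw [Finset.sum_div]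
  refine Finset.sum_congr rfl fun k _ => ?_
  rw [div_mul_div_comm]
  congr 1
  · ring
  · linear_combination 4 * h

theorem sum_smul_leechVec (c : Fin 24 → ℤ) :
    ∑ i, c i • leechVec i = ofCoords fun k => ∑ i, c i * leechRows i k := by
  ext k
  simp [leechVec, ofCoords, Finset.sum_div, mul_div_assoc]

theorem leechVec_mem (i : Fin 24) : leechVec i ∈ leech :=
  AddSubgroup.subset_closure ⟨i, rfl⟩

theorem exists_coeff {x : E24} (hx : x ∈ leech) :
    ∃ c : Fin 24 → ℤ, x = ∑ i, c i • leechVec i := by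
  obtain ⟨c, hc⟩ := AddSubgroup.mem_closure_range_iff.1 hx
  exact ⟨c, hc.trans (Finsupp.sum_fintype _ _ fun _ => zero_smul _ _)⟩

/-! ### The minimum norm -/

/-- Whether `P` holds for the sums (bitwise, modulo `2`) of `v` and all sublists of a list of
binary words. -/
def allXor (P : ℕ → Bool) : List ℕ → ℕ → Bool
  | [], v => P v
  | g :: gs, v => allXor P gs v && (g == 0 || allXor P gs (v ^^^ g))

/-- Only the parities of the integer coefficients matter, so a finite check over sublists covers
every integral combination. -/
theorem exists_of_allXor {P : ℕ → Bool} (L : List (ℤ × ℕ)) (v : ℕ)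
    (h : allXor P (L.map Prod.snd) v = true) :
    ∃ u, P u = true ∧ ∀ k : ℕ,
      ((v.testBit k).toNat + (L.map fun p => p.1 * ((p.2.testBit k).toNat : ℤ)).sum) % 2 =
        ((u.testBit k).toNat : ℤ) := by
  induction L generalizing v with
  | nil =>
    refine ⟨v, h, fun k => ?_⟩
    cases v.testBit k <;> simp
  | cons p L ih =>
    simp only [List.map_cons, allXor, Bool.and_eq_true, Bool.or_eq_true, beq_iff_eq] at h
    simp only [List.map_cons, List.sum_cons]
    -- An even coefficient or a zero word changes nothing modulo 2; otherwise the word is added to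
    -- `v`.
    by_cases hp : p.1 % 2 = 0 ∨ p.2 = 0
    · obtain ⟨u, hu, hk⟩ := ih v h.1
      refine ⟨u, hu, fun k => ?_⟩
      rw [← hk]
      rcases hp with hp | hp
      · obtain ⟨n, hn⟩ := Int.dvd_of_emod_eq_zero hp
        rw [hn, mul_assoc]
        omega
      · simp [hp]
    · push Not at hp
      obtain ⟨u, hu, hk⟩ := ih _ (h.2.resolve_left hp.2)
      refine ⟨u, hu, fun k => ?_⟩
      rw [← hk, Nat.testBit_xor]
      cases v.testBit k <;> cases p.2.testBit k <;> simp <;> omega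

/-- Minimum weight 8 of the Golay code. Zero words do not branch, so the twelve nonzero words lead
to `2 ^ 12` evaluations. -/
theorem golay_weight : allXor (fun u => u == 0 || 8 ≤ ∑ k : Fin 24, (u.testBit k).toNat)
    (List.ofFn golayWord) 0 = true := by
  decide +kernel

/-- The rows of the generator matrix, with the last row doubled. -/
def evenRows (i k : Fin 24) : ℤ := (if i = 23 then 2 else 1) * leechRows i k

theorem evenRows_mod_four :
    ∀ i k, (evenRows i k - 2 * ((golayWord i).testBit k).toNat) % 4 = 0 := by
  decide +kernel

theorem evenRows_sum : ∀ i, (∑ k, evenRows i k) % 8 = 0 := by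
  decide +kernel

theorem leechRows_parity : ∀ i k, (leechRows i k - if i = 23 then 1 else 0) % 2 = 0 := by
  decide +kernel

/-- Half the coordinates reduce modulo 2 to a code word. Weight at least 8 is too long, so the word
is zero, all coordinates are multiples of 4, and exactly one would be `±4`; this contradicts the
coordinate sum being divisible by 8. -/
theorem even_coords_sq_sum_ne (a : Fin 24 → ℤ) :
    ∑ k, (∑ i, a i * evenRows i k) ^ 2 ≠ 16 := by
  intro h16
  obtain ⟨u, hu, hbit⟩ := exists_of_allXor (List.ofFn fun i => (a i, golayWord i)) 0
    (by rw [List.map_ofFn]; exact golay_weight)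
  simp only [List.map_ofFn, Function.comp_def, List.sum_ofFn, Nat.zero_testBit, Bool.toNat_false,
    Nat.cast_zero, zero_add, Bool.or_eq_true, beq_iff_eq, decide_eq_true_eq] at hu hbit
  have hw : ∀ k, ∃ w : ℤ, ∑ i, a i * evenRows i k = 2 * w ∧
      w % 2 = ((u.testBit k).toNat : ℤ) := by
    intro k
    choose r hr using fun i => Int.dvd_of_emod_eq_zero (evenRows_mod_four i k)
    refine ⟨∑ i, a i * ((golayWord i).testBit k).toNat + 2 * ∑ i, a i * r i, ?_, ?_⟩
    · rw [mul_add, Finset.mul_sum, Finset.mul_sum, Finset.mul_sum, ← Finset.sum_add_distrib]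
      refine Finset.sum_congr rfl fun i _ => ?_
      linear_combination a i * hr i
    · rw [Int.add_mul_emod_self_left, hbit k]
  choose w hw hw2 using hw
  simp only [hw] at h16
  have h4 : ∑ k, w k ^ 2 = 4 := by
    have : ∑ k, (2 * w k) ^ 2 = 4 * ∑ k, w k ^ 2 := by
      rw [Finset.mul_sum]; exact Finset.sum_congr rfl fun _ _ => by ring
    omega
  have hu0 : u = 0 := by
    refine hu.resolve_right fun h8 => ?_
    have : ∑ k : Fin 24, ((u.testBit k).toNat : ℤ) ≤ ∑ k, w k ^ 2 := by
      refine Finset.sum_le_sum fun k _ => ?_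
      rw [← hw2]
      rcases Int.emod_two_eq_zero_or_one (w k) with h | h
      · rw [h]; positivity
      · rw [h]
        have : w k ≠ 0 := fun h0 => by simp [h0] at h
        have := sq_pos_of_ne_zero this
        omega
    have h8' : (8 : ℤ) ≤ ∑ k : Fin 24, ((u.testBit k).toNat : ℤ) := by exact_mod_cast h8
    omega
  have he : ∀ k, ∃ t, w k = 2 * t := fun k =>
    Int.dvd_of_emod_eq_zero (by rw [hw2, hu0]; simp)
  choose t ht using he
  have h1 : ∑ k, t k ^ 2 = 1 := by
    have : ∑ k, w k ^ 2 = 4 * ∑ k, t k ^ 2 := by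
      rw [Finset.mul_sum]; exact Finset.sum_congr rfl fun k _ => by rw [ht]; ring
    omega
  have hs : ∃ n, ∑ k, t k = 2 * n := by
    choose r hr using fun i => Int.dvd_of_emod_eq_zero (evenRows_sum i)
    have : ∑ k, 4 * t k = 8 * ∑ i, a i * r i := by
      calc ∑ k, 4 * t k = ∑ k, ∑ i, a i * evenRows i k :=
            Finset.sum_congr rfl fun k _ => by rw [hw, ht]; ring
        _ = ∑ i, a i * ∑ k, evenRows i k := by
            rw [Finset.sum_comm]; simp only [Finset.mul_sum]
        _ = _ := by
            rw [Finset.mul_sum]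
            exact Finset.sum_congr rfl fun i _ => by rw [hr]; ring
    rw [← Finset.mul_sum] at this
    exact ⟨∑ i, a i * r i, by omega⟩
  obtain ⟨n, hn⟩ := hs
  -- Since `t² ≡ t` modulo 2, a square sum of 1 cannot go with an even sum.
  have hd : (2 : ℤ) ∣ ∑ k, t k ^ 2 - ∑ k, t k := by
    rw [← Finset.sum_sub_distrib]
    refine Finset.dvd_sum fun k _ => ?_
    have := Int.even_mul_pred_self (t k)
    rw [even_iff_two_dvd] at this
    convert this using 1
    ring
  omega

theorem coords_sq_sum_ne (c : Fin 24 → ℤ) : ∑ k, (∑ i, c i * leechRows i k) ^ 2 ≠ 16 := by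
  rcases Int.even_or_odd' (c 23) with ⟨d, hd | hd⟩
  -- An even coefficient `2 * d` of the last row is the coefficient `d` of the doubled row.
  · convert even_coords_sq_sum_ne (Function.update c 23 d) using 4 with k _ i _
    by_cases hi : i = 23
    · subst hi; simp [evenRows, hd]; ring
    · simp [evenRows, hi]
  -- Here every coordinate is odd, so the square sum is at least 24.
  · have hodd : ∀ k, 1 ≤ (∑ i, c i * leechRows i k) ^ 2 := by
      intro k
      choose r hr using fun i => Int.dvd_of_emod_eq_zero (leechRows_parity i k)
      have : ∑ i, c i * leechRows i k = 2 * ∑ i, c i * r i + c 23 := by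
        have h : ∀ i, c i * leechRows i k = 2 * (c i * r i) + if i = 23 then c i else 0 := by
          intro i
          have := hr i
          split_ifs at this ⊢ <;> linear_combination c i * this
        simp only [h, Finset.sum_add_distrib, Finset.mul_sum]
        simp
      have h0 : ∑ i, c i * leechRows i k ≠ 0 := by omega
      have := sq_pos_of_ne_zero h0
      omega
    have := Finset.sum_le_sum fun k (_ : k ∈ Finset.univ) => hodd k
    simp only [Finset.sum_const, Finset.card_univ, Fintype.card_fin] at this
    intro h
    rw [h] at this
    norm_num at this

theorem inner_self_ne_two {x : E24} (hx : x ∈ leech) : ⟪x, x⟫ ≠ 2 := by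
  obtain ⟨c, rfl⟩ := exists_coeff hx
  rw [sum_smul_leechVec, ofCoords_inner]
  intro h
  have h' : ((∑ k, (∑ i, c i * leechRows i k) * (∑ i, c i * leechRows i k) : ℤ) : ℝ) = 16 := by
    linarith
  refine coords_sq_sum_ne c ?_
  simp only [sq]
  exact_mod_cast h'

theorem isLeast_norm : IsLeast {r : ℝ | ∃ x ∈ leech, x ≠ 0 ∧ r = ‖x‖ ^ 2} 4 := by
  constructor
  · have h : ⟪leechVec 1, leechVec 1⟫ = 4 := by
      have : ∑ k, leechRows 1 k * leechRows 1 k = 32 := by decide +kernel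
      rw [leechVec_inner, this]
      norm_num
    refine ⟨leechVec 1, leechVec_mem 1, fun h0 => ?_, ?_⟩
    · rw [h0, inner_zero_left] at h
      norm_num at h
    · rw [← real_inner_self_eq_norm_sq, h]
  · rintro _ ⟨x, hx, h0, rfl⟩
    rw [← real_inner_self_eq_norm_sq]
    obtain ⟨n, hn⟩ := exists_norm_sq_eq hx
    have h2 := inner_self_ne_two hx
    have hpos : 0 < ⟪x, x⟫ := real_inner_self_pos.2 h0
    rw [hn] at h2 hpos ⊢
    have h1 : n ≠ 1 := by rintro rfl; norm_num at h2
    have h3 : 0 < n := by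
      have : (0 : ℝ) < n := by linarith
      exact_mod_cast this
    have : (2 : ℝ) ≤ n := by exact_mod_cast (by omega : 2 ≤ n)
    linarith

/-! ### A basis of the lattice and its Gram matrix -/

/-- The inner product of the lattice as a bilinear form over the integers. -/
def ipForm : LinearMap.BilinForm ℤ leech :=
  (AddMonoidHom.mk' (fun x => (AddMonoidHom.mk' (ip x) fun y z => by
    have h := ip_spec x (y + z)
    rw [AddSubgroup.coe_add, inner_add_right, ip_spec, ip_spec] at h
    exact_mod_cast h.symm).toIntLinearMap) fun x y => by
    ext z
    exact ip_add_left x y z).toIntLinearMap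

theorem ipForm_apply (x y : leech) : ipForm x y = ip x y := rfl

theorem ip_comm (x y : leech) : ip x y = ip y x := by
  have h := ip_spec x y
  rw [real_inner_comm, ip_spec] at h
  exact_mod_cast h.symm

theorem ip_self (x : leech) : ip x x = 2 * halfNorm x := by
  have h := ip_spec x x
  rw [halfNorm_spec] at h
  exact_mod_cast h.symm

/-- The generators, as elements of the lattice. -/
def leechGen (i : Fin 24) : leech := ⟨leechVec i, leechVec_mem i⟩

theorem ip_leechGen (i j : Fin 24) :
    8 * ip (leechGen i) (leechGen j) = ∑ k, leechRows i k * leechRows j k := by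
  have h := ip_spec (leechGen i) (leechGen j)
  simp only [leechGen, leechVec_inner] at h
  have h' : ((∑ k, leechRows i k * leechRows j k : ℤ) : ℝ) =
      ((8 * ip (leechGen i) (leechGen j) : ℤ) : ℝ) := by
    rw [Int.cast_mul, leechGen, leechGen, ← h]
    push_cast
    ring
  exact_mod_cast h'.symm

theorem leechRows_lower : ∀ i j, i < j → leechRows i j = 0 := by
  decide +kernel

theorem prod_leechRows_diag : ∏ i, leechRows i i = 2 ^ 36 := by
  decide +kernel

theorem det_leechRows : (Matrix.of leechRows).det = 2 ^ 36 := by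
  rw [Matrix.det_of_isLowerTriangular (Matrix.of leechRows)
    fun i j hij => leechRows_lower i j hij]
  exact prod_leechRows_diag

/-- The Gram matrix of the generators. -/
def gram : Matrix (Fin 24) (Fin 24) ℤ := Matrix.of fun i j => ip (leechGen i) (leechGen j)

/-- Unimodularity: `8 ^ 24 * det gram = (2 ^ 36) ^ 2 = 2 ^ 72`. -/
theorem det_gram : gram.det = 1 := by
  have h : (8 : ℤ) • gram = Matrix.of leechRows * (Matrix.of leechRows).transpose := by
    ext i j
    simp [gram, Matrix.mul_apply, ip_leechGen]
  have h2 := congrArg Matrix.det h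
  rw [Matrix.det_smul, Matrix.det_mul, Matrix.det_transpose, det_leechRows,
    Fintype.card_fin] at h2
  norm_num at h2
  omega

theorem linearIndependent_leechGen : LinearIndependent ℤ leechGen := by
  rw [Fintype.linearIndependent_iff]
  intro c hc
  have h : Matrix.vecMul c gram = 0 := by
    ext j
    have := congrArg (fun x => ipForm x (leechGen j)) hc
    simpa [Matrix.vecMul, dotProduct, gram, ipForm_apply] using this
  exact congrFun (Matrix.eq_zero_of_vecMul_eq_zero (by rw [det_gram]; norm_num) h)

/-- The generators form a basis of the lattice. -/
def leechBasis : Module.Basis (Fin 24) ℤ leech :=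
  Module.Basis.mk linearIndependent_leechGen (by
    rintro ⟨x, hx⟩ -
    obtain ⟨c, rfl⟩ := exists_coeff hx
    have : (⟨∑ i, c i • leechVec i, hx⟩ : leech) = ∑ i, c i • leechGen i := by
      ext1
      simp [leechGen]
    rw [this]
    exact Submodule.sum_mem _ fun i _ =>
      Submodule.smul_mem _ _ (Submodule.subset_span ⟨i, rfl⟩))

@[simp] theorem leechBasis_apply (i : Fin 24) : leechBasis i = leechGen i := by
  simp [leechBasis]

instance : Module.Free ℤ leech := .of_basis leechBasis
instance : Module.Finite ℤ leech := .of_basis leechBasis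

theorem toMatrix_ipForm : LinearMap.BilinForm.toMatrix leechBasis ipForm = gram := by
  ext i j
  simp [LinearMap.BilinForm.toMatrix_apply, gram, ipForm_apply]

/-! ### Existence of cocycles -/

/-- The bilinear form whose matrix is the part of the Gram matrix below the diagonal. -/
def lowerForm : LinearMap.BilinForm ℤ leech :=
  leechBasis.constr ℤ fun i => leechBasis.constr ℤ fun j => if j < i then gram i j else 0

/-- The bilinear form whose matrix is half the diagonal of the Gram matrix. -/
def diagForm : LinearMap.BilinForm ℤ leech :=
  leechBasis.constr ℤ fun i => leechBasis.constr ℤ fun j =>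
    if i = j then halfNorm (leechGen i) else 0

/-- The diagonal can be halved over `ℤ` because the lattice is even. -/
theorem ipForm_eq : ipForm = lowerForm + lowerForm.flip + (2 : ℤ) • diagForm := by
  refine leechBasis.ext fun i => leechBasis.ext fun j => ?_
  simp only [LinearMap.add_apply, LinearMap.smul_apply, LinearMap.BilinForm.flip_apply, lowerForm, diagForm,
    Module.Basis.constr_basis, ipForm_apply, gram, Matrix.of_apply]
  rcases lt_trichotomy i j with h | rfl | h
  · simp [h, h.not_gt, h.ne, ip_comm (leechGen i)]
  · simp [ip_self]
  · simp [h, h.not_gt, h.ne']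

/-- A sign `(-1) ^ B` with `B` bilinear is always a cocycle; its commutator is governed by `B` plus
its transpose, which for `lowerForm` agrees with the inner product modulo 2. -/
theorem nonempty_leechCocycle : Nonempty LeechCocycle := by
  refine ⟨⟨fun x y => (-1) ^ lowerForm x y, fun x y z => ?_, fun x y => ?_⟩⟩
  · simp only [← zpow_add, map_add, LinearMap.add_apply]
    congr 1
    ring
  · have h := congrArg (fun F => F x y) ipForm_eq
    simp only [ipForm_apply, LinearMap.add_apply, LinearMap.smul_apply, LinearMap.BilinForm.flip_apply,
      smul_eq_mul] at h
    have h2 : ip x y + lowerForm y x = lowerForm x y + 2 * (lowerForm y x + diagForm x y) := by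
      rw [h]; ring
    rw [← zpow_add, h2, zpow_add, zpow_mul]
    simp

/-! ### Similarities doubling the norm -/


theorem toMatrix_similarity {f : leech →+ leech} (hf : ∀ x y, ip (f x) (f y) = 2 * ip x y) :
    (LinearMap.toMatrix leechBasis leechBasis f.toIntLinearMap).transpose * gram *
      LinearMap.toMatrix leechBasis leechBasis f.toIntLinearMap = (2 : ℤ) • gram := by
  rw [← toMatrix_ipForm, ← LinearMap.BilinForm.toMatrix_comp, ← map_smul]
  congr 1
  ext x y
  simp [LinearMap.BilinForm.comp_apply, ipForm_apply, hf]

theorem det_similarity_sq {f : leech →+ leech} (hf : ∀ x y, ip (f x) (f y) = 2 * ip x y) :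
    LinearMap.det f.toIntLinearMap ^ 2 = 2 ^ 24 := by
  have h := congrArg Matrix.det (toMatrix_similarity hf)
  rw [Matrix.det_mul, Matrix.det_mul, Matrix.det_transpose, Matrix.det_smul, det_gram,
    LinearMap.det_toMatrix, Fintype.card_fin] at h
  linear_combination h

theorem similarity_injective {f : leech →+ leech} (hf : ∀ x y, ip (f x) (f y) = 2 * ip x y) :
    Function.Injective f := by
  refine (injective_iff_map_eq_zero f).2 fun x hx => ?_
  have h0 : ipForm (f x) (f x) = 0 := by rw [hx]; simp
  have h := hf x x
  rw [← ipForm_apply, h0] at h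
  have h2 := ip_spec x x
  rw [show ip x x = 0 by omega, Int.cast_zero, inner_self_eq_zero] at h2
  exact_mod_cast h2

theorem index_range_eq_natAbs_det {M : Type*} [AddCommGroup M] [Module.Free ℤ M]
    [Module.Finite ℤ M] {f : M →+ M} (hf : Function.Injective f) :
    f.range.index = (LinearMap.det f.toIntLinearMap).natAbs :=
  (Submodule.natAbs_det_equiv f.range.toIntSubmodule (AddMonoidHom.ofInjective hf)).symm

theorem index_range_similarity {f : leech →+ leech}
    (hf : ∀ x y, ip (f x) (f y) = 2 * ip x y) : f.range.index = 2 ^ 12 := by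
  rw [index_range_eq_natAbs_det (similarity_injective hf)]
  have h := congrArg Int.natAbs (det_similarity_sq hf)
  rw [Int.natAbs_pow, Int.natAbs_pow, show Int.natAbs 2 ^ 24 = (2 ^ 12) ^ 2 by norm_num] at h
  exact Nat.pow_left_injective two_ne_zero h

theorem index_twoLeech : twoLeech.index = 2 ^ 24 := by
  have hinj : Function.Injective (nsmulAddMonoidHom 2 : leech →+ leech) := fun x y h => by
    have h' : (2 : ℤ) • x = (2 : ℤ) • y := by
      simpa only [nsmulAddMonoidHom_apply, two_nsmul, two_zsmul] using h
    exact smul_right_injective leech two_ne_zero h'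
  have h2 : (nsmulAddMonoidHom 2 : leech →+ leech).toIntLinearMap =
      (2 : ℤ) • LinearMap.id := by
    ext x
    simp [two_nsmul]
  rw [twoLeech, index_range_eq_natAbs_det hinj, h2, LinearMap.det_smul, LinearMap.det_id,
    Module.finrank_eq_card_basis leechBasis]
  norm_num

/-- The matrix `A'` is that of the adjoint of `f`, integral because the Gram matrix is unimodular.
Then `2x = f (f* x)`. -/
theorem twoLeech_le_range {f : leech →+ leech} (hf : ∀ x y, ip (f x) (f y) = 2 * ip x y) :
    twoLeech ≤ f.range := by
  set A := LinearMap.toMatrix leechBasis leechBasis f.toIntLinearMap with hA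
  set A' := gram⁻¹ * (A.transpose * gram)
  have hu : IsUnit gram.det := by rw [det_gram]; exact isUnit_one
  have h1 : A' * A = (2 : ℤ) • 1 := by
    rw [mul_assoc, toMatrix_similarity hf, Matrix.mul_smul, Matrix.nonsing_inv_mul _ hu]
  have hdet : A'.det ≠ 0 := by
    intro h0
    have h := congrArg Matrix.det h1
    rw [Matrix.det_mul, h0, zero_mul, Matrix.det_smul, Matrix.det_one] at h
    norm_num at h
  -- `A'` is not invertible over `ℤ`, so it is cancelled using its adjugate and nonzero determinant.
  have h2 : A * A' = (2 : ℤ) • 1 := by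
    have h : A' * (A * A' - (2 : ℤ) • 1) = 0 := by
      rw [mul_sub, ← mul_assoc, h1, Matrix.smul_mul, Matrix.mul_smul, one_mul, mul_one, sub_self]
    have h3 := congrArg (A'.adjugate * ·) h
    simp only [← mul_assoc, Matrix.adjugate_mul, mul_zero, Matrix.smul_mul, one_mul] at h3
    exact sub_eq_zero.1 ((smul_eq_zero.1 h3).resolve_left hdet)
  rintro _ ⟨x, rfl⟩
  have h3 := congrArg (Matrix.toLin leechBasis leechBasis) h2
  rw [Matrix.toLin_mul leechBasis leechBasis leechBasis, hA, Matrix.toLin_toMatrix, map_smul,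
    Matrix.toLin_one] at h3
  have h4 := LinearMap.congr_fun h3 x
  refine ⟨Matrix.toLin leechBasis leechBasis A' x, ?_⟩
  simpa [two_nsmul, two_zsmul] using h4

theorem relIndex_range_similarity {f : leech →+ leech}
    (hf : ∀ x y, ip (f x) (f y) = 2 * ip x y) : twoLeech.relIndex f.range = 2 ^ 12 := by
  have h := AddSubgroup.relIndex_mul_index (twoLeech_le_range hf)
  rw [index_range_similarity hf, index_twoLeech] at h
  omega

/-! ### Existence of a similarity doubling the norm -/

/-- Certifies that `1 + σ` maps the generators into the lattice. -/
theorem similarityMatrix_mul_leechRows : ∀ i k, ∑ j, similarityMatrix i j * leechRows j k =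
    leechRows i k + coordSign k * leechRows i (coordPerm k) := by
  decide +kernel

theorem similarity_rows_gram : ∀ i j,
    ∑ k, (leechRows i k + coordSign k * leechRows i (coordPerm k)) *
      (leechRows j k + coordSign k * leechRows j (coordPerm k)) =
    2 * ∑ k, leechRows i k * leechRows j k := by
  decide +kernel

theorem exists_similarity : ∃ f : leech →+ leech, ∀ x y, ip (f x) (f y) = 2 * ip x y := by
  let g : leech →ₗ[ℤ] leech :=
    leechBasis.constr ℤ fun i => ∑ j, similarityMatrix i j • leechGen j
  have hg (i : Fin 24) : ((g (leechBasis i) : leech) : E24) =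
      ofCoords fun k => leechRows i k + coordSign k * leechRows i (coordPerm k) := by
    simp only [g, Module.Basis.constr_basis, ← similarityMatrix_mul_leechRows]
    rw [← sum_smul_leechVec]
    simp [leechGen]
  have h : ipForm.comp g g = (2 : ℤ) • ipForm := by
    refine leechBasis.ext fun i => leechBasis.ext fun j => ?_
    simp only [LinearMap.BilinForm.comp_apply, LinearMap.smul_apply, ipForm_apply, smul_eq_mul]
    have h1 := ip_spec (g (leechBasis i)) (g (leechBasis j))
    rw [hg, hg, ofCoords_inner, similarity_rows_gram, ← ip_leechGen] at h1
    rw [leechBasis_apply, leechBasis_apply] at h1 ⊢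
    have h2 : ((2 * ip (leechGen i) (leechGen j) : ℤ) : ℝ) =
        ip (g (leechGen i)) (g (leechGen j)) := by
      rw [← h1]
      push_cast
      ring
    exact_mod_cast h2.symm
  exact ⟨g.toAddMonoidHom, fun x y => LinearMap.congr_fun₂ h x y⟩

/-! ### Lifting sublattices to the Heisenberg group -/

/-- Groups of exponent 2 are `F₂`-vector spaces, where surjections split. -/
theorem exists_rightInverse_of_mul_self_eq_one {A B : Type*} [CommGroup A] [CommGroup B]
    (hA : ∀ a : A, a * a = 1) (hB : ∀ b : B, b * b = 1) (φ : A →* B)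
    (hφ : Function.Surjective φ) : ∃ s : B →* A, ∀ b, φ (s b) = b := by
  let : Module (ZMod 2) (Additive A) :=
    AddCommGroup.zmodModule fun a => (two_nsmul a).trans (hA a.toMul)
  let : Module (ZMod 2) (Additive B) :=
    AddCommGroup.zmodModule fun b => (two_nsmul b).trans (hB b.toMul)
  obtain ⟨s, hs⟩ := (φ.toAdditive.toZModLinearMap 2).exists_rightInverse_of_surjective
    (LinearMap.range_eq_top.2 hφ)
  exact ⟨AddMonoidHom.toMultiplicative s.toAddMonoidHom,
    fun b => LinearMap.congr_fun hs (Additive.ofMul b)⟩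

theorem Heis.bar_surjective (ε : LeechCocycle) : Function.Surjective (Heis.bar ε) := by
  intro x
  obtain ⟨v, hv⟩ := QuotientAddGroup.mk_surjective x.toAdd
  exact ⟨QuotientGroup.mk ⟨1, v⟩, congrArg Multiplicative.ofAdd hv⟩

theorem Heis.mul_comm_of_even {ε : LeechCocycle} {a b : LeechHat ε} (h : Even (ip a.vec b.vec)) :
    (a * b : Heis ε) = b * a := by
  rw [← QuotientGroup.mk_mul, LeechHat.mul_eq a b, h.neg_one_zpow, map_one, mul_one,
    QuotientGroup.mk_mul]

theorem Heis.mul_self_of_even {ε : LeechCocycle} {a : LeechHat ε} (h : Even (halfNorm a.vec)) :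
    (a * a : Heis ε) = 1 := by
  rw [← QuotientGroup.mk_mul, QuotientGroup.eq_one_iff]
  exact ⟨a, by rw [h.neg_one_zpow, map_one, mul_one]⟩

/-- Only the evenness of inner products and half-norms on `M` is needed: they make the full preimage
`L` of `M / 2Λ` elementary abelian, and the image of a splitting is the required subgroup. -/
theorem exists_abelian_lift (ε : LeechCocycle) {M : AddSubgroup leech} (h2 : twoLeech ≤ M)
    (hip : ∀ x ∈ M, ∀ y ∈ M, Even (ip x y)) (hnorm : ∀ x ∈ M, Even (halfNorm x)) :
    ∃ (e : Heis.Section ε) (H : Subgroup (Heis ε)),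
      (H : Set (Heis ε)) = e.toFun '' (M.map (QuotientAddGroup.mk' twoLeech) : Set LeechModTwo) ∧
      (∀ g ∈ H, ∀ h ∈ H, g * h = h * g) ∧ Nat.card H = twoLeech.relIndex M := by
  set N := M.map (QuotientAddGroup.mk' twoLeech) with hN
  let B : Subgroup (Multiplicative LeechModTwo) := AddSubgroup.toSubgroup N
  let L : Subgroup (Heis ε) := B.comap (Heis.bar ε)
  -- As `2Λ ⊆ M`, membership in `M` depends only on the class modulo `2Λ`.
  have hL : ∀ a : LeechHat ε, (a : Heis ε) ∈ L → a.vec ∈ M := by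
    rintro a ⟨v, hv, hva⟩
    have h : -v + a.vec ∈ twoLeech := QuotientAddGroup.eq.1 hva
    simpa using M.add_mem hv (h2 h)
  have hcomm : ∀ g ∈ L, ∀ h ∈ L, g * h = h * g := by
    intro g hg h hh
    induction g using QuotientGroup.induction_on with | H a =>
    induction h using QuotientGroup.induction_on with | H b =>
    exact Heis.mul_comm_of_even (hip _ (hL a hg) _ (hL b hh))
  have hsq : ∀ g ∈ L, g * g = 1 := by
    intro g hg
    induction g using QuotientGroup.induction_on with | H a =>
    exact Heis.mul_self_of_even (hnorm _ (hL a hg))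
  let : CommGroup L := { (inferInstance : Group L) with
    mul_comm := fun g h => Subtype.ext (hcomm g g.2 h h.2) }
  have hB : ∀ b : B, b * b = 1 := by
    rintro ⟨b, v, hv, hvb⟩
    refine Subtype.ext ?_
    change b.toAdd + b.toAdd = 0
    rw [← hvb]
    exact (QuotientAddGroup.eq_zero_iff (v + v)).2 ⟨v, by simp [two_nsmul]⟩
  let φ : L →* B := (Heis.bar ε).subgroupComap B
  have hφ : Function.Surjective φ := by
    rintro ⟨b, hb⟩
    obtain ⟨g, rfl⟩ := Heis.bar_surjective ε b
    exact ⟨⟨g, hb⟩, rfl⟩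
  obtain ⟨s, hs⟩ := exists_rightInverse_of_mul_self_eq_one
    (fun g => Subtype.ext (hsq g g.2)) hB φ hφ
  have hs' : ∀ b : B, Heis.bar ε (s b) = b := fun b => congrArg Subtype.val (hs b)
  classical
  -- The splitting on `M / 2Λ`, arbitrary preimages elsewhere; `e_[0] = 1` because the splitting is
  -- a homomorphism.
  let e : Heis.Section ε :=
    { toFun := fun x => if h : Multiplicative.ofAdd x ∈ B then (s ⟨_, h⟩ : Heis ε)
        else (Heis.bar_surjective ε (Multiplicative.ofAdd x)).choose
      bar_toFun := fun x => by
        split_ifs with h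
        · exact hs' ⟨_, h⟩
        · exact (Heis.bar_surjective ε (Multiplicative.ofAdd x)).choose_spec
      map_zero := by
        rw [dif_pos (show Multiplicative.ofAdd (0 : LeechModTwo) ∈ B from B.one_mem)]
        exact congrArg Subtype.val (map_one s) }
  have he : ∀ b : B, e.toFun (b : Multiplicative LeechModTwo).toAdd = s b := fun b => dif_pos b.2
  have hinj : Function.Injective (L.subtype.comp s) := fun b c h => Subtype.ext (by
    rw [← hs' b, ← hs' c]
    exact congrArg (Heis.bar ε) h)
  refine ⟨e, (L.subtype.comp s).range, ?_, ?_, ?_⟩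
  · ext g
    constructor
    · rintro ⟨b, rfl⟩
      exact ⟨(b : Multiplicative LeechModTwo).toAdd, b.2, he b⟩
    · rintro ⟨x, hx, rfl⟩
      exact ⟨⟨Multiplicative.ofAdd x, hx⟩, (he ⟨_, hx⟩).symm⟩
  · rintro _ ⟨b, rfl⟩ _ ⟨c, rfl⟩
    exact hcomm _ (s b).2 _ (s c).2
  · calc Nat.card (L.subtype.comp s).range = Nat.card B :=
          (Nat.card_congr (MonoidHom.ofInjective hinj).toEquiv).symm
      _ = Nat.card N := rfl
      _ = _ := by
          rw [hN, ← AddSubgroup.relIndex_ker, QuotientAddGroup.ker_mk']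

/-! ### Superconformal sublattices -/

theorem isSuperconformal_range_similarity (ε : LeechCocycle) {f : leech →+ leech}
    (hf : ∀ x y, ip (f x) (f y) = 2 * ip x y) : IsSuperconformal ε f.range := by
  have hhalf : ∀ x, halfNorm (f x) = 2 * halfNorm x := by
    intro x
    have h := hf x x
    rw [ip_self, ip_self] at h
    omega
  refine ⟨?_, ?_, ?_, twoLeech_le_range hf, relIndex_range_similarity hf, ?_⟩
  · rintro _ ⟨x, rfl⟩ _ ⟨y, rfl⟩
    exact ⟨ip x y, by rw [ip_spec, hf]; push_cast; rfl⟩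
  · rintro _ ⟨x, rfl⟩
    exact ⟨halfNorm x, by
      rw [← real_inner_self_eq_norm_sq, halfNorm_spec, hhalf]; push_cast; ring⟩
  · rintro _ ⟨x, rfl⟩ h
    rw [← real_inner_self_eq_norm_sq, halfNorm_spec, hhalf] at h
    refine inner_self_ne_two x.2 ?_
    rw [halfNorm_spec]
    push_cast at h
    linarith
  · rw [← relIndex_range_similarity hf]
    refine exists_abelian_lift ε (twoLeech_le_range hf) ?_ ?_
    · rintro _ ⟨x, rfl⟩ _ ⟨y, rfl⟩
      exact ⟨ip x y, by rw [hf]; ring⟩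
    · rintro _ ⟨x, rfl⟩
      exact ⟨halfNorm x, by rw [hhalf]; ring⟩

/-! ### From similarities to embeddings of `√2 Λ` -/

/-- Multiplication by `√2`, as an isomorphism of `Λ` with `√2 Λ`. -/
def scaleEquiv : leech ≃+ sqrtTwoLeech :=
  AddEquiv.ofBijective
    (AddMonoidHom.mk' (fun x : leech => (⟨Real.sqrt 2 • (x : E24),
      AddSubgroup.smul_mem_pointwise_smul _ _ _ x.2⟩ : sqrtTwoLeech)) fun x y => by
        ext1
        simp)
    ⟨fun x y h => by
      have h' : Real.sqrt 2 • (x : E24) = Real.sqrt 2 • (y : E24) := congrArg Subtype.val h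
      exact Subtype.ext (smul_right_injective E24 (by positivity : Real.sqrt 2 ≠ 0) h'),
    fun ⟨_, x, hx, h⟩ => ⟨⟨x, hx⟩, Subtype.ext h⟩⟩

theorem scaleEquiv_inner (x y : leech) :
    ⟪(scaleEquiv x : E24), (scaleEquiv y : E24)⟫ = ((2 * ip x y : ℤ) : ℝ) := by
  change ⟪Real.sqrt 2 • (x : E24), Real.sqrt 2 • (y : E24)⟫ = _
  rw [real_inner_smul_left, real_inner_smul_right, ← mul_assoc,
    Real.mul_self_sqrt (by norm_num), ip_spec]
  push_cast
  rfl

theorem exists_isIsometricEmbedding : ∃ ι : sqrtTwoLeech →+ leech, IsIsometricEmbedding ι := by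
  obtain ⟨f, hf⟩ := exists_similarity
  refine ⟨f.comp scaleEquiv.symm.toAddMonoidHom, fun x y => ?_⟩
  obtain ⟨x, rfl⟩ := scaleEquiv.surjective x
  obtain ⟨y, rfl⟩ := scaleEquiv.surjective y
  rw [scaleEquiv_inner, ← hf, ← ip_spec]
  simp

theorem IsIsometricEmbedding.isSuperconformal (ε : LeechCocycle) {ι : sqrtTwoLeech →+ leech}
    (hι : IsIsometricEmbedding ι) : IsSuperconformal ε ι.range := by
  have hf : ∀ x y, ip (ι.comp scaleEquiv.toAddMonoidHom x) (ι.comp scaleEquiv.toAddMonoidHom y) =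
      2 * ip x y := by
    intro x y
    have h := (hι (scaleEquiv x) (scaleEquiv y)).trans (scaleEquiv_inner x y)
    rw [ip_spec] at h
    exact_mod_cast h
  have hr : (ι.comp scaleEquiv.toAddMonoidHom).range = ι.range := by
    have htop : scaleEquiv.toAddMonoidHom.range = ⊤ :=
      AddMonoidHom.range_eq_top.2 scaleEquiv.surjective
    rw [AddMonoidHom.range_comp, htop, AddMonoidHom.range_eq_map]
  rw [← hr]
  exact isSuperconformal_range_similarity ε hf

end LeechSC

end

/-! ### The main theorem -/

theorem mainTheorem4 :
    -- the minimum norm (squared length) of the Leech lattice is `4`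
    IsLeast {r : ℝ | ∃ x ∈ LeechSC.leech, x ≠ 0 ∧ r = ‖x‖ ^ 2} 4 ∧
    -- a cocycle defining the central extension of the Leech lattice exists
    Nonempty LeechSC.LeechCocycle ∧
    -- there is an isometric embedding of `√2 Λ` into `Λ`
    (∃ ι : LeechSC.sqrtTwoLeech →+ LeechSC.leech, LeechSC.IsIsometricEmbedding ι) ∧
    -- the image of every such embedding is a superconformal sublattice
    (∀ (ε : LeechSC.LeechCocycle) (ι : LeechSC.sqrtTwoLeech →+ LeechSC.leech),
      LeechSC.IsIsometricEmbedding ι → LeechSC.IsSuperconformal ε ι.range) ∧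
    -- in particular a superconformal sublattice exists, whatever the cocycle chosen
    (∃ M : AddSubgroup LeechSC.leech, ∀ ε : LeechSC.LeechCocycle,
      LeechSC.IsSuperconformal ε M) := by
  refine ⟨LeechSC.isLeast_norm, LeechSC.nonempty_leechCocycle, LeechSC.exists_isIsometricEmbedding,
    fun ε _ hι => hι.isSuperconformal ε, ?_⟩
  obtain ⟨ι, hι⟩ := LeechSC.exists_isIsometricEmbedding
  exact ⟨ι.range, fun ε => hι.isSuperconformal ε⟩
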